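/- Let $a<b$ and $0<T\le\infty$. Let $X_0:\mathbb{R}\to\mathbb{R}^2$ be a smooth $(b-a)$-periodic regular parametrization of a simple closed convex plane curve (injective on $[a,b)$, oriented counterclockwise). For a regular closed curve with $(b-a)$-periodic parameter $u$ write $g=|X_u|$, $ds=g\,du$, $\partial_s=\frac1g\partial_u$, $\mathsf{T}=\partial_sX$ for the unit tangent, $\theta$ for the direction angle of $\mathsf{T}$, $\kappa=\partial_s\theta$ for the signed curvature, $\mathsf{N}=\frac1\kappa\partial_s\mathsf{T}$ for the unit normal and $\partial_\theta=\frac1\kappa\partial_s$ (where $\kappa\ne0$), $L=\oint ds$ for the length, and $A=\frac12\oint x\,dy-y\,dx$ for the enclosed area, all integrals being taken over the period $[a,b]$. Let $X(u,t)$, $u\in\mathbb{R}$, $t\in[0,T)$, be a smooth family of regular curves (smooth up to $t=0$), $(b-a)$-periodic in $u$, with nowhere vanishing curvature, which satisfies $$\frac{\partial X}{\partial t}=\eta\,\mathsf{T}+\Big(\kappa-\frac{\lambda(t)}{\kappa}\Big)\mathsf{N},\qquad X(u,0)=X_0(u),$$ where $$\lambda(t)=\frac{2\pi}{\oint\frac1\kappa\,ds},\qquad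 \eta=-\frac{\partial}{\partial\theta}\Big(\kappa-\frac{\lambda(t)}{\kappa}\Big).$$ Then the area $A(t)$ and the length $L(t)$ of the curve $X(\cdot,t)$ are differentiable on $[0,T)$ (one-sided at $t=0$), and for every $t\in[0,T)$ $$\frac{dA}{dt}=0,\qquad \frac{dL}{dt}\le0.$$ -/

import Mathlib

open scoped ContDiff RealInnerProductSpace

noncomputable section

namespace CurveFlow

/-- The Euclidean plane. -/
abbrev Plane := EuclideanSpace ℝ (Fin 2)

/-- Rotation of the plane by a right angle, counterclockwise. -/
def rot (v : Plane) : Plane := !₂[-v 1, v 0]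

/-- The metric `g = |γ_u|` along a parametrized curve `γ`. -/
def speed (γ : ℝ → Plane) (u : ℝ) : ℝ := ‖deriv γ u‖

/-- The derivative `∂f/∂s = (1/g) ∂f/∂u` of a function `f` along `γ` with respect to
the arc length of `γ`. -/
def arcDeriv {E : Type*} [NormedAddCommGroup E] [NormedSpace ℝ E]
    (γ : ℝ → Plane) (f : ℝ → E) (u : ℝ) : E :=
  (speed γ u)⁻¹ • deriv f u

/-- The unit tangent vector `T = ∂γ/∂s`. -/
def tangent (γ : ℝ → Plane) : ℝ → Plane := arcDeriv γ γ

/-- The signed curvature, `⟪∂T/∂s, rot T⟫`. If `θ` is a (differentiable) direction angle of the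
curve, that is `T = (cos θ, sin θ)`, then `∂T/∂s = (∂θ/∂s) rot T` and this number is `∂θ/∂s`. -/
def curvature (γ : ℝ → Plane) (u : ℝ) : ℝ :=
  ⟪arcDeriv γ (tangent γ) u, rot (tangent γ u)⟫

/-- The unit normal vector `N = (1/κ) ∂T/∂s`, at points where the curvature does not vanish. -/
def normal (γ : ℝ → Plane) (u : ℝ) : Plane :=
  (curvature γ u)⁻¹ • arcDeriv γ (tangent γ) u

/-- The derivative `∂f/∂θ = (1/κ) ∂f/∂s` of a function along `γ` with respect to the direction
angle, at points where the curvature does not vanish. -/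
def angleDeriv (γ : ℝ → Plane) (f : ℝ → ℝ) (u : ℝ) : ℝ :=
  (curvature γ u)⁻¹ * arcDeriv γ f u

/-- The length `L = ∮ ds`. -/
def length (a b : ℝ) (γ : ℝ → Plane) : ℝ := ∫ u in a..b, speed γ u

/-- The (algebraic) enclosed area `A = (1/2) ∮ x dy - y dx`. -/
def area (a b : ℝ) (γ : ℝ → Plane) : ℝ :=
  (1 / 2) * ∫ u in a..b, (γ u 0 * deriv γ u 1 - γ u 1 * deriv γ u 0)

/-- The nonlocal term `λ = 2π / ∮ (1/κ) ds`. -/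
def nonlocalTerm (a b : ℝ) (γ : ℝ → Plane) : ℝ :=
  2 * Real.pi / ∫ u in a..b, (1 / curvature γ u) * speed γ u

/-- The normal component `κ - λ/κ` of the velocity. -/
def normalSpeed (a b : ℝ) (γ : ℝ → Plane) (u : ℝ) : ℝ :=
  curvature γ u - nonlocalTerm a b γ / curvature γ u

/-- The tangential component `η = -∂/∂θ (κ - λ/κ)` of the velocity. -/
def tangentialSpeed (a b : ℝ) (γ : ℝ → Plane) (u : ℝ) : ℝ :=
  -angleDeriv γ (normalSpeed a b γ) u

/-- `γ` is a smooth, regular, simple closed convex plane curve, parametrized counterclockwise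
over the period `[a, b]`: the curve lies on one side of each of its tangent lines, namely on the
left-hand side. -/
structure IsConvexClosedCurve (a b : ℝ) (γ : ℝ → Plane) : Prop where
  smooth : ContDiff ℝ ∞ γ
  periodic : Function.Periodic γ (b - a)
  regular : ∀ u, deriv γ u ≠ 0
  simple : Set.InjOn γ (Set.Ico a b)
  convex : ∀ u v, 0 ≤ ⟪γ v - γ u, rot (tangent γ u)⟫

/-- The time interval `[0, T)`, where `T` may be `∞`. -/
def timeInterval (T : EReal) : Set ℝ := {t | 0 ≤ t ∧ (t : EReal) < T}

/-- `X u t` is a smooth solution on `[0, T)`, with initial curve `X₀`, of the flow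
`∂X/∂t = η T + (κ - λ/κ) N` of regular closed plane curves. The nonvanishing of the curvature is
what is needed for the right-hand side of the equation to make sense. At `t = 0` the time
derivative is one-sided. -/
structure IsSolution (a b : ℝ) (T : EReal) (X₀ : ℝ → Plane) (X : ℝ → ℝ → Plane) : Prop where
  smooth : ContDiffOn ℝ ∞ (fun p : ℝ × ℝ => X p.1 p.2) (Set.univ ×ˢ timeInterval T)
  periodic : ∀ t ∈ timeInterval T, Function.Periodic (fun u => X u t) (b - a)
  regular : ∀ t ∈ timeInterval T, ∀ u, deriv (fun v => X v t) u ≠ 0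
  curvature_ne_zero : ∀ t ∈ timeInterval T, ∀ u, curvature (fun v => X v t) u ≠ 0
  evolution : ∀ t ∈ timeInterval T, ∀ u,
    HasDerivWithinAt (fun τ => X u τ)
      (tangentialSpeed a b (fun v => X v t) u • tangent (fun v => X v t) u
        + normalSpeed a b (fun v => X v t) u • normal (fun v => X v t) u)
      (timeInterval T) t
  initial : ∀ u, X u 0 = X₀ u

end CurveFlow

end

noncomputable section

namespace CurveFlow

open Set Filter Topology

/-! ### The time interval -/

/-! Let F = κ - λ/κ be the normal speed. Differentiating under the integral and integrating by parts
over a period gives dA/dt = -∮ F ds and dL/dt = -∮ κ F ds (`hasDerivWithinAt_area`,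
`hasDerivWithinAt_length`). The tangential velocity enters only through a total u-derivative, which
periodicity kills.

Both signs rest on ∮ κ ds = 2π and κ > 0. For the initial curve, supporting lines force κ > 0 and
make points with equal tangents coincide, so simplicity allows only one full turn. At later times
the total curvature is a continuous function of t with values in 2πℤ, hence constant. Since κ never
vanishes, it has constant sign, and this sign is positive (`total_curvature`, `curvature_pos`).

Then ∮ F ds = 2π - λ ∮ ds/κ = 0 by the choice of λ. For the length, multiply the Cauchy-Schwarz
inequalities (∮ κ ds)² ≤ L ∮ κ² ds and L² ≤ ∮ κ ds ∮ ds/κ and cancel, which gives λL ≤ ∮ κ² ds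
(`integral_mul_sub_div_nonneg`). -/

lemma convex_timeInterval (T : EReal) : Convex ℝ (timeInterval T) := by
  refine OrdConnected.convex ⟨fun x hx y hy z hz => ⟨hx.1.trans hz.1, ?_⟩⟩
  exact lt_of_le_of_lt (EReal.coe_le_coe_iff.2 hz.2) hy.2

lemma zero_mem_timeInterval {T : EReal} (hT : 0 < T) : (0 : ℝ) ∈ timeInterval T :=
  ⟨le_rfl, by simpa using hT⟩

lemma interior_timeInterval_nonempty {T : EReal} (hT : 0 < T) :
    (interior (timeInterval T)).Nonempty := by
  obtain ⟨r, hr0, hrT⟩ := EReal.lt_iff_exists_real_btwn.1 hT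
  have hr : (0 : ℝ) < r := by exact_mod_cast hr0
  refine ⟨r / 2, mem_interior.2 ⟨Ioo 0 r, fun x hx => ⟨hx.1.le, ?_⟩, isOpen_Ioo, ?_⟩⟩
  · exact (EReal.coe_lt_coe_iff.2 hx.2).trans hrT
  · constructor <;> linarith

/-! ### Differentiation under the integral sign on a convex set of parameters -/

/-- Compactness of [a, b] makes F' u τ uniformly close to F' u t for τ near t. The mean value
inequality for σ ↦ F u σ - σ F' u t on a convex neighbourhood in S then bounds the remainder
uniformly in u. Working within S covers the one-sided derivative at t = 0. -/
lemma hasDerivWithinAt_intervalIntegral_of_continuousOn {S : Set ℝ} (hS : Convex ℝ S) {a b : ℝ}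
    (hab : a ≤ b) {F F' : ℝ → ℝ → ℝ} (hF : ∀ t ∈ S, Continuous fun u => F u t)
    (hF' : ContinuousOn (fun p : ℝ × ℝ => F' p.1 p.2) (univ ×ˢ S))
    (hd : ∀ t ∈ S, ∀ u, HasDerivWithinAt (F u) (F' u t) S t) {t : ℝ} (ht : t ∈ S) :
    HasDerivWithinAt (fun τ => ∫ u in a..b, F u τ) (∫ u in a..b, F' u t) S t := by
  rw [hasDerivWithinAt_iff_isLittleO, Asymptotics.isLittleO_iff]
  intro ε hε
  -- The added 1 keeps the denominator positive when a = b.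
  set δ := ε / (b - a + 1) with hδ
  have hba : 0 < b - a + 1 := by linarith
  have hδ0 : 0 < δ := by positivity
  have hF'c : ∀ τ ∈ S, Continuous fun u => F' u τ := fun τ hτ =>
    hF'.comp_continuous (by fun_prop : Continuous fun u : ℝ => (u, τ)) fun u => ⟨mem_univ _, hτ⟩
  have hcont : ContinuousOn (Function.uncurry fun τ u => F' u τ) (S ×ˢ Icc a b) :=
    hF'.comp (by fun_prop : ContinuousOn (fun p : ℝ × ℝ => (p.2, p.1)) _)
      fun p hp => ⟨mem_univ _, hp.1⟩
  obtain ⟨v, hv, hvb⟩ := isCompact_Icc.mem_uniformity_of_prod hcont ht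
    (Metric.dist_mem_uniformity hδ0)
  obtain ⟨r, hr, hrv⟩ := Metric.mem_nhdsWithin_iff.1 hv
  filter_upwards [inter_mem_nhdsWithin S (Metric.ball_mem_nhds t hr)] with τ hτ
  have key : ∀ u ∈ Icc a b, ‖F u τ - F u t - (τ - t) * F' u t‖ ≤ δ * ‖τ - t‖ := by
    intro u hu
    have h := Convex.norm_image_sub_le_of_norm_hasDerivWithin_le (s := S ∩ Metric.ball t r)
      (f := fun σ => F u σ - σ * F' u t) (f' := fun σ => F' u σ - 1 * F' u t) (C := δ)
      (fun σ hσ => ((hd σ hσ.1 u).mono inter_subset_left).sub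
        ((hasDerivWithinAt_id σ _).mul_const _))
      (fun σ hσ => by
        have := hvb σ (hrv ⟨hσ.2, hσ.1⟩) u hu
        rw [mem_ofPred_eq, Real.dist_eq] at this
        simpa using this.le)
      (hS.inter (convex_ball t r)) ⟨ht, Metric.mem_ball_self hr⟩ hτ
    rwa [show F u τ - τ * F' u t - (F u t - t * F' u t) = F u τ - F u t - (τ - t) * F' u t by
      ring] at h
  have hint : (∫ u in a..b, F u τ) - (∫ u in a..b, F u t) - (τ - t) • ∫ u in a..b, F' u t
      = ∫ u in a..b, (F u τ - F u t - (τ - t) * F' u t) := by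
    rw [intervalIntegral.integral_sub, intervalIntegral.integral_sub,
      intervalIntegral.integral_const_mul, smul_eq_mul]
    · exact (hF τ hτ.1).intervalIntegrable _ _
    · exact (hF t ht).intervalIntegrable _ _
    · exact ((hF τ hτ.1).sub (hF t ht)).intervalIntegrable _ _
    · exact (continuous_const.mul (hF'c t ht)).intervalIntegrable _ _
  rw [hint]
  refine (intervalIntegral.norm_integral_le_of_norm_le_const (C := δ * ‖τ - t‖)
    fun u hu => key u ?_).trans ?_
  · rw [uIoc_of_le hab] at hu
    exact ⟨hu.1.le, hu.2⟩
  · rw [abs_of_nonneg (sub_nonneg.2 hab)]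
    have : δ * (b - a) ≤ ε := by
      rw [hδ, div_mul_eq_mul_div, div_le_iff₀ hba]
      nlinarith
    nlinarith [norm_nonneg (τ - t)]

/-! ### Partial derivatives on `ℝ × S` -/

section Partial

variable {E : Type*} [NormedAddCommGroup E] [NormedSpace ℝ E]

/-- The partial derivative along `w` of a function on `ℝ × S`. -/
def partialWithin (S : Set ℝ) (w : ℝ × ℝ) (F : ℝ × ℝ → E) (p : ℝ × ℝ) : E :=
  fderivWithin ℝ F (univ ×ˢ S) p w

variable {S : Set ℝ} {F : ℝ × ℝ → E}

lemma interior_univ_prod_nonempty (hi : (interior S).Nonempty) :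
    (interior ((univ : Set ℝ) ×ˢ S)).Nonempty := by
  rw [interior_prod_eq, interior_univ]
  exact univ_nonempty.prod hi

lemma uniqueDiffOn_univ_prod (hS : Convex ℝ S) (hi : (interior S).Nonempty) :
    UniqueDiffOn ℝ ((univ : Set ℝ) ×ˢ S) :=
  uniqueDiffOn_convex (convex_univ.prod hS) (interior_univ_prod_nonempty hi)

lemma contDiffOn_partialWithin (hS : Convex ℝ S) (hi : (interior S).Nonempty)
    (hF : ContDiffOn ℝ ∞ F (univ ×ˢ S)) (w : ℝ × ℝ) :
    ContDiffOn ℝ ∞ (partialWithin S w F) (univ ×ˢ S) :=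
  (hF.fderivWithin (uniqueDiffOn_univ_prod hS hi) (by simp)).clm_apply contDiffOn_const

lemma hasDerivAt_partialWithin (hF : ContDiffOn ℝ ∞ F (univ ×ˢ S)) {t : ℝ} (ht : t ∈ S)
    (u : ℝ) : HasDerivAt (fun v => F (v, t)) (partialWithin S (1, 0) F (u, t)) u := by
  have h := (hF.differentiableOn (by simp) (u, t) ⟨mem_univ _, ht⟩).hasFDerivWithinAt
  have hc : HasDerivWithinAt (fun v : ℝ => (v, t)) (1, 0) univ u :=
    (hasDerivWithinAt_id u _).prodMk (hasDerivWithinAt_const u _ t)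
  exact hasDerivWithinAt_univ.1
    (h.comp_hasDerivWithinAt (f := fun v : ℝ => (v, t)) u hc fun v _ => ⟨mem_univ _, ht⟩)

lemma hasDerivWithinAt_partialWithin (hF : ContDiffOn ℝ ∞ F (univ ×ˢ S)) {t : ℝ} (ht : t ∈ S)
    (u : ℝ) : HasDerivWithinAt (fun τ => F (u, τ)) (partialWithin S (0, 1) F (u, t)) S t := by
  have h := (hF.differentiableOn (by simp) (u, t) ⟨mem_univ _, ht⟩).hasFDerivWithinAt
  have hc : HasDerivWithinAt (fun τ : ℝ => (u, τ)) (0, 1) S t :=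
    (hasDerivWithinAt_const t _ u).prodMk (hasDerivWithinAt_id t _)
  exact h.comp_hasDerivWithinAt (f := fun τ : ℝ => (u, τ)) t hc fun τ hτ => ⟨mem_univ _, hτ⟩

/-- Symmetry of the second derivative persists at boundary points, because a convex set with
nonempty interior lies in the closure of its interior. -/
lemma partialWithin_comm (hS : Convex ℝ S) (hi : (interior S).Nonempty)
    (hF : ContDiffOn ℝ ∞ F (univ ×ˢ S)) (v w : ℝ × ℝ) {p : ℝ × ℝ} (hp : p ∈ univ ×ˢ S) :
    partialWithin S v (partialWithin S w F) p = partialWithin S w (partialWithin S v F) p := by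
  have hU := uniqueDiffOn_univ_prod hS hi
  have hd : DifferentiableWithinAt ℝ (fderivWithin ℝ F (univ ×ˢ S)) (univ ×ˢ S) p :=
    (hF.fderivWithin hU (m := ∞) (by simp)).differentiableOn (by simp) p hp
  have hval : ∀ v w : ℝ × ℝ, partialWithin S v (partialWithin S w F) p
      = fderivWithin ℝ (fderivWithin ℝ F (univ ×ˢ S)) (univ ×ˢ S) p v w := by
    intro v w
    unfold partialWithin
    rw [fderivWithin_clm_apply (hU p hp) hd (differentiableWithinAt_const w)]
    simp
  have hcl : p ∈ closure (interior ((univ : Set ℝ) ×ˢ S)) := by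
    rw [(convex_univ.prod hS).closure_interior_eq_closure_of_nonempty_interior
      (interior_univ_prod_nonempty hi)]
    exact subset_closure hp
  rw [hval, hval]
  exact (hF p hp).isSymmSndFDerivWithinAt (by simpa using WithTop.coe_le_coe.2 (le_top (a := (2 : ℕ∞)))) hU hcl hp v w

end Partial

lemma continuous_slice {Y : Type*} [TopologicalSpace Y] {S : Set ℝ} {G : ℝ × ℝ → Y} (hG : ContinuousOn G (univ ×ˢ S)) {t : ℝ} (ht : t ∈ S) :
    Continuous fun u => G (u, t) :=
  hG.comp_continuous (by fun_prop) fun u => ⟨mem_univ _, ht⟩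

/-- An integral of a jointly continuous function with values in a multiple of the integers
does not depend on the parameter. -/
lemma intervalIntegral_const_of_int_valued {S : Set ℝ} (hS : Convex ℝ S) {a b c : ℝ} (hc : c ≠ 0)
    {G : ℝ × ℝ → ℝ} (hG : ContinuousOn G (univ ×ˢ S))
    (hz : ∀ t ∈ S, ∃ n : ℤ, ∫ u in a..b, G (u, t) = n * c) {s t : ℝ} (hs : s ∈ S) (ht : t ∈ S) :
    ∫ u in a..b, G (u, s) = ∫ u in a..b, G (u, t) := by
  have hcont : Continuous fun τ : S => ∫ u in a..b, G (u, τ) := by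
    refine intervalIntegral.continuous_parametric_intervalIntegral_of_continuous'
      (f := fun (τ : S) u => G (u, τ)) ?_ a b
    exact hG.comp_continuous (by fun_prop : Continuous fun p : S × ℝ => (p.2, (p.1 : ℝ)))
      fun p => ⟨mem_univ _, p.1.2⟩
  choose n hn using fun τ : S => hz τ τ.2
  have hn' : Continuous n := by
    rw [Int.isClosedEmbedding_coe_real.isInducing.continuous_iff]
    refine (hcont.div_const c).congr fun τ => ?_
    rw [hn τ]
    simp [hc]
  have : PreconnectedSpace S := isPreconnected_iff_preconnectedSpace.1 hS.isPreconnected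
  have h := PreconnectedSpace.constant this hn' (x := ⟨s, hs⟩) (y := ⟨t, ht⟩)
  rw [hn ⟨s, hs⟩, hn ⟨t, ht⟩, h]

/-! ### The plane -/

lemma inner_plane (v w : Plane) : ⟪v, w⟫ = v 0 * w 0 + v 1 * w 1 := by
  simp [PiLp.inner_apply, Fin.sum_univ_two, mul_comm]

/-- The rotation by a right angle as a continuous linear map. -/
def rotL : Plane →L[ℝ] Plane :=
  LinearMap.toContinuousLinearMap
    { toFun := rot
      map_add' := fun v w => by ext i; fin_cases i <;> simp [rot]; ring
      map_smul' := fun c v => by ext i; fin_cases i <;> simp [rot] }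

@[simp] lemma rot_zero (v : Plane) : rot v 0 = -v 1 := by simp [rot]

@[simp] lemma rot_one (v : Plane) : rot v 1 = v 0 := by simp [rot]

/-- A vector orthogonal to a unit vector is a multiple of the rotated unit vector. -/
lemma eq_inner_rot_smul {v w : Plane} (hv : ⟪v, v⟫ = 1) (hw : ⟪w, v⟫ = 0) :
    w = ⟪w, rot v⟫ • rot v := by
  rw [inner_plane] at hv hw
  rw [inner_plane]
  ext i
  fin_cases i
  · simp only [Fin.zero_eta, PiLp.smul_apply, rot_zero, rot_one, smul_eq_mul]
    linear_combination (-w 0) * hv + v 0 * hw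
  · simp only [Fin.mk_one, PiLp.smul_apply, rot_zero, rot_one, smul_eq_mul]
    linear_combination (-w 1) * hv + v 1 * hw

/-! ### Regular curves -/

section Curve

variable {γ : ℝ → Plane}

lemma speed_pos (hr : ∀ u, deriv γ u ≠ 0) (u : ℝ) : 0 < speed γ u := norm_pos_iff.2 (hr u)

lemma deriv_eq_speed_smul_tangent (hr : ∀ u, deriv γ u ≠ 0) (u : ℝ) :
    deriv γ u = speed γ u • tangent γ u := by
  rw [tangent, arcDeriv, smul_inv_smul₀ (speed_pos hr u).ne']

lemma inner_tangent_self (hr : ∀ u, deriv γ u ≠ 0) (u : ℝ) :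
    ⟪tangent γ u, tangent γ u⟫ = 1 := by
  rw [real_inner_self_eq_norm_sq, tangent, arcDeriv, norm_smul, norm_inv, Real.norm_eq_abs,
    abs_of_pos (speed_pos hr u)]
  have := (speed_pos hr u).ne'
  unfold speed at this ⊢
  field_simp

lemma contDiff_deriv (hγ : ContDiff ℝ ∞ γ) : ContDiff ℝ ∞ (deriv γ) :=
  (contDiff_infty_iff_deriv.1 hγ).2

lemma contDiff_speed (hγ : ContDiff ℝ ∞ γ) (hr : ∀ u, deriv γ u ≠ 0) :
    ContDiff ℝ ∞ (speed γ) := (contDiff_deriv hγ).norm ℝ hr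

lemma contDiff_tangent (hγ : ContDiff ℝ ∞ γ) (hr : ∀ u, deriv γ u ≠ 0) :
    ContDiff ℝ ∞ (tangent γ) :=
  ((contDiff_speed hγ hr).inv fun u => (speed_pos hr u).ne').smul (contDiff_deriv hγ)

lemma hasDerivAt_tangent (hγ : ContDiff ℝ ∞ γ) (hr : ∀ u, deriv γ u ≠ 0) (u : ℝ) :
    HasDerivAt (tangent γ) (deriv (tangent γ) u) u :=
  ((contDiff_tangent hγ hr).differentiable (by simp) u).hasDerivAt

lemma inner_deriv_tangent (hγ : ContDiff ℝ ∞ γ) (hr : ∀ u, deriv γ u ≠ 0) (u : ℝ) :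
    ⟪deriv (tangent γ) u, tangent γ u⟫ = 0 := by
  have h := (hasDerivAt_tangent hγ hr u).inner ℝ (hasDerivAt_tangent hγ hr u)
  have h1 : (fun v => ⟪tangent γ v, tangent γ v⟫) = fun _ => (1 : ℝ) :=
    funext (inner_tangent_self hr)
  rw [h1] at h
  have := h.unique (hasDerivAt_const u (1 : ℝ))
  rw [real_inner_comm] at this
  linarith

lemma speed_mul_curvature (hr : ∀ u, deriv γ u ≠ 0) (u : ℝ) :
    speed γ u * curvature γ u = ⟪deriv (tangent γ) u, rot (tangent γ u)⟫ := by
  rw [curvature, arcDeriv, real_inner_smul_left, mul_inv_cancel_left₀ (speed_pos hr u).ne']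

/-- The Frenet equation `T_u = g κ N`. -/
lemma deriv_tangent (hγ : ContDiff ℝ ∞ γ) (hr : ∀ u, deriv γ u ≠ 0) (u : ℝ) :
    deriv (tangent γ) u = (speed γ u * curvature γ u) • rot (tangent γ u) := by
  rw [speed_mul_curvature hr]
  exact eq_inner_rot_smul (inner_tangent_self hr u) (inner_deriv_tangent hγ hr u)

lemma normal_eq_rot_tangent (hγ : ContDiff ℝ ∞ γ) (hr : ∀ u, deriv γ u ≠ 0) {u : ℝ}
    (hκ : curvature γ u ≠ 0) : normal γ u = rot (tangent γ u) := by
  have := (speed_pos hr u).ne'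
  rw [normal, arcDeriv, deriv_tangent hγ hr, smul_smul, smul_smul]
  convert one_smul ℝ _
  field_simp

lemma continuous_speed_mul_curvature (hγ : ContDiff ℝ ∞ γ) (hr : ∀ u, deriv γ u ≠ 0) :
    Continuous fun u => speed γ u * curvature γ u := by
  simp only [speed_mul_curvature hr]
  exact ((contDiff_tangent hγ hr).continuous_deriv (by simp)).inner
    (rotL.continuous.comp (contDiff_tangent hγ hr).continuous)

lemma continuous_curvature (hγ : ContDiff ℝ ∞ γ) (hr : ∀ u, deriv γ u ≠ 0) :
    Continuous (curvature γ) := by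
  refine ((continuous_speed_mul_curvature hγ hr).div (contDiff_speed hγ hr).continuous
    fun u => (speed_pos hr u).ne').congr fun u => ?_
  exact mul_div_cancel_left₀ _ (speed_pos hr u).ne'

lemma periodic_deriv {E : Type*} [NormedAddCommGroup E] [NormedSpace ℝ E] {f : ℝ → E} {c : ℝ}
    (hf : Function.Periodic f c) : Function.Periodic (deriv f) c := fun u => by
  rw [← deriv_comp_add_const, hf.funext]

lemma periodic_tangent {c : ℝ} (hp : Function.Periodic γ c) :
    Function.Periodic (tangent γ) c := fun u => by
  simp only [tangent, arcDeriv, speed, periodic_deriv hp u]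

/-- The unit tangent as a complex number. -/
def tangentC (γ : ℝ → Plane) (u : ℝ) : ℂ := tangent γ u 0 + tangent γ u 1 * Complex.I

lemma tangentC_injective {u v : ℝ} (h : tangentC γ u = tangentC γ v) :
    tangent γ u = tangent γ v := by
  have h0 := congrArg Complex.re h
  have h1 := congrArg Complex.im h
  simp [tangentC] at h0 h1
  ext i
  fin_cases i
  · exact h0
  · exact h1

lemma tangentC_ne_zero (hr : ∀ u, deriv γ u ≠ 0) (u : ℝ) : tangentC γ u ≠ 0 := by
  intro h
  have h0 := congrArg Complex.re h
  have h1 := congrArg Complex.im h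
  simp [tangentC] at h0 h1
  have := inner_tangent_self hr u
  rw [inner_plane, h0, h1] at this
  norm_num at this

lemma hasDerivAt_coord {f : ℝ → Plane} {f' : Plane} {u : ℝ} (h : HasDerivAt f f' u) (i : Fin 2) :
    HasDerivAt (fun v => f v i) (f' i) u :=
  (EuclideanSpace.proj (𝕜 := ℝ) i).hasFDerivAt.comp_hasDerivAt u h

lemma hasDerivAt_tangentC (hγ : ContDiff ℝ ∞ γ) (hr : ∀ u, deriv γ u ≠ 0) (u : ℝ) :
    HasDerivAt (tangentC γ) (((speed γ u * curvature γ u : ℝ) : ℂ) * Complex.I * tangentC γ u)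
      u := by
  have h := hasDerivAt_tangent hγ hr u
  have h0 := (hasDerivAt_coord h 0).ofReal_comp
  have h1 := ((hasDerivAt_coord h 1).ofReal_comp).mul_const Complex.I
  refine (h0.add h1).congr_deriv ?_
  rw [deriv_tangent hγ hr]
  simp only [PiLp.smul_apply, rot_zero, rot_one, smul_eq_mul, tangentC]
  push_cast
  linear_combination (-(speed γ u : ℂ) * curvature γ u * tangent γ u 1) * Complex.I_mul_I

/-- The direction angle turns by `∫ κ ds`. -/
lemma tangentC_eq_exp_mul (hγ : ContDiff ℝ ∞ γ) (hr : ∀ u, deriv γ u ≠ 0) (a x : ℝ) :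
    tangentC γ x = Complex.exp ((∫ u in a..x, speed γ u * curvature γ u : ℝ) * Complex.I) *
      tangentC γ a := by
  set φ : ℝ → ℝ := fun x => ∫ u in a..x, speed γ u * curvature γ u with hφ
  have hφd : ∀ x, HasDerivAt φ (speed γ x * curvature γ x) x := fun x =>
    intervalIntegral.integral_hasDerivAt_right
      ((continuous_speed_mul_curvature hγ hr).intervalIntegrable _ _)
      (continuous_speed_mul_curvature hγ hr).stronglyMeasurable.stronglyMeasurableAtFilter
      (continuous_speed_mul_curvature hγ hr).continuousAt
  -- Integrating factor: e^{-iφ} times the complex tangent is constant, since the tangent solves z'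
  -- = iφ'z.
  have hd : ∀ x,
      HasDerivAt (fun x => Complex.exp (-((φ x : ℂ) * Complex.I)) * tangentC γ x) 0 x := by
    intro x
    refine ((((hφd x).ofReal_comp.mul_const Complex.I).neg.cexp).mul
      (hasDerivAt_tangentC hγ hr x)).congr_deriv ?_
    ring
  have hc := is_const_of_deriv_eq_zero (fun x => (hd x).differentiableAt) (fun x => (hd x).deriv) x a
  have ha : φ a = 0 := by simp [hφ]
  simp only [ha, Complex.ofReal_zero, zero_mul, neg_zero, Complex.exp_zero, one_mul] at hc
  rw [← hc, ← mul_assoc, ← Complex.exp_add]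
  simp [hφ]

/-- The total curvature of a closed curve is an integral multiple of `2π`. -/
lemma exists_int_total_curvature (hγ : ContDiff ℝ ∞ γ) (hr : ∀ u, deriv γ u ≠ 0) {a b : ℝ}
    (hp : Function.Periodic γ (b - a)) :
    ∃ n : ℤ, ∫ u in a..b, speed γ u * curvature γ u = n * (2 * Real.pi) := by
  have h := tangentC_eq_exp_mul hγ hr a b
  have hba : tangentC γ b = tangentC γ a := by
    have := periodic_tangent hp a
    rw [add_sub_cancel] at this
    simp only [tangentC, this]
  rw [hba, eq_comm, mul_eq_right₀ (tangentC_ne_zero hr a), Complex.exp_eq_one_iff] at h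
  obtain ⟨n, hn⟩ := h
  refine ⟨n, ?_⟩
  have := congrArg Complex.im hn
  simpa using this

end Curve

/-! ### Convex curves -/

section Convex

variable {γ : ℝ → Plane} {a b : ℝ}

/-- This is the signed distance from a fixed point p to the moving tangent line. The motion of the
base point is along that line, so only the rotation of the line contributes. -/
lemma hasDerivAt_inner_rot_tangent (hγ : ContDiff ℝ ∞ γ) (hr : ∀ u, deriv γ u ≠ 0) (p : Plane)
    (u : ℝ) :
    HasDerivAt (fun v => ⟪p - γ v, rot (tangent γ v)⟫)
      (-(speed γ u * curvature γ u) * ⟪p - γ u, tangent γ u⟫) u := by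
  have h1 : HasDerivAt (fun v => p - γ v) (-deriv γ u) u :=
    ((hγ.differentiable (by simp) u).hasDerivAt).const_sub p
  have h2 : HasDerivAt (fun v => rot (tangent γ v)) (rot (deriv (tangent γ) u)) u :=
    rotL.hasFDerivAt.comp_hasDerivAt u (hasDerivAt_tangent hγ hr u)
  refine (h1.inner ℝ h2).congr_deriv ?_
  rw [deriv_tangent hγ hr, deriv_eq_speed_smul_tangent hr]
  simp only [inner_plane, rot_zero, rot_one, PiLp.smul_apply, PiLp.neg_apply, PiLp.sub_apply,
    smul_eq_mul]
  ring

/-- Two points of a convex curve with the same tangent direction coincide, if the curvature does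
not vanish at one of them. -/
lemma IsConvexClosedCurve.eq_of_tangent_eq (h : IsConvexClosedCurve a b γ) {u v : ℝ}
    (hκ : curvature γ u ≠ 0) (ht : tangent γ u = tangent γ v) : γ u = γ v := by
  -- The tangent lines at u and v are parallel with the same orientation, and each point lies to the
  -- left of the other's line, so the lines agree.
  have h0 : ⟪γ v - γ u, rot (tangent γ u)⟫ = 0 := by
    refine le_antisymm ?_ (h.convex u v)
    have := h.convex v u
    rw [← ht, ← neg_sub, inner_neg_left] at this
    linarith
  -- The distance from γ v to the tangent line at w is nonnegative and vanishes at w = u. Its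
  -- derivative is therefore zero there, and since κ ≠ 0 this kills the tangential component of γ v
  -- - γ u too.
  have hmin : IsLocalMin (fun w => ⟪γ v - γ w, rot (tangent γ w)⟫) u := by
    refine Eventually.of_forall fun w => ?_
    simp only [h0]
    exact h.convex w v
  have hd := hmin.hasDerivAt_eq_zero (hasDerivAt_inner_rot_tangent h.smooth h.regular (γ v) u)
  have h1 : ⟪γ v - γ u, tangent γ u⟫ = 0 := by
    have := (speed_pos h.regular u).ne'
    simpa [this, hκ] using hd
  have h2 := eq_inner_rot_smul (inner_tangent_self h.regular u) h1
  rw [h0, zero_smul, sub_eq_zero] at h2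
  exact h2.symm

/-- A convex curve with nonvanishing curvature has positive curvature. -/
lemma IsConvexClosedCurve.curvature_pos (h : IsConvexClosedCurve a b γ)
    (hκ : ∀ u, curvature γ u ≠ 0) (u : ℝ) : 0 < curvature γ u := by
  refine (hκ u).lt_or_gt.resolve_left fun hneg => ?_
  set N := rot (tangent γ u) with hN
  -- Height above the tangent line at u: f ≥ 0, f(u) = f'(u) = 0 and f''(u) = g²κ. If κ(u) < 0, then
  -- u is also a local maximum, so f vanishes near u, contradicting f''(u) < 0.
  set f : ℝ → ℝ := fun v => ⟪γ v - γ u, N⟫ with hf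
  have hdγ : ∀ v, HasDerivAt γ (deriv γ v) v := fun v =>
    (h.smooth.differentiable (by simp) v).hasDerivAt
  have hf1 : deriv f = fun v => ⟪deriv γ v, N⟫ := by
    funext v
    have := ((hdγ v).sub_const (γ u)).inner ℝ (hasDerivAt_const v N)
    simpa using this.deriv
  have hT0 : ⟪tangent γ u, N⟫ = 0 := by
    rw [inner_plane, hN, rot_zero, rot_one]
    ring
  have hNN : ⟪N, N⟫ = 1 := by
    rw [← inner_tangent_self h.regular u, inner_plane, inner_plane, hN, rot_zero, rot_one]
    ring
  have hγ1 : deriv γ = fun v => speed γ v • tangent γ v :=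
    funext (deriv_eq_speed_smul_tangent h.regular)
  have hf2 : deriv (deriv f) u = speed γ u * (speed γ u * curvature γ u) := by
    have hs : HasDerivAt (speed γ) (deriv (speed γ) u) u :=
      ((contDiff_speed h.smooth h.regular).differentiable (by simp) u).hasDerivAt
    have h2 := (hs.smul (hasDerivAt_tangent h.smooth h.regular u)).inner ℝ (hasDerivAt_const u N)
    rw [hf1, hγ1]
    refine h2.deriv.trans ?_
    rw [deriv_tangent h.smooth h.regular, ← hN, inner_zero_right, zero_add, inner_add_left,
      real_inner_smul_left, real_inner_smul_left, real_inner_smul_left, hT0, hNN]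
    ring
  have hs := speed_pos h.regular u
  have hf2neg : deriv (deriv f) u < 0 := by
    rw [hf2]
    exact mul_neg_of_pos_of_neg hs (mul_neg_of_pos_of_neg hs hneg)
  have hf1u : deriv f u = 0 := by
    simp only [hf1]
    rw [deriv_eq_speed_smul_tangent h.regular, real_inner_smul_left, hT0, mul_zero]
  have hfc : ContinuousAt f u :=
    ((h.smooth.continuous.sub continuous_const).inner continuous_const).continuousAt
  have hmax := isLocalMax_of_deriv_deriv_neg hf2neg hf1u hfc
  have hfu : f u = 0 := by simp [hf]
  have hzero : f =ᶠ[𝓝 u] fun _ => 0 := by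
    filter_upwards [hmax] with v hv
    exact le_antisymm (hv.trans hfu.le) (h.convex u v)
  have := hzero.deriv.deriv.eq_of_nhds
  simp at this
  exact hf2neg.ne this

/-- The total curvature of a convex curve with nonvanishing curvature is `2π`. -/
lemma IsConvexClosedCurve.total_curvature (h : IsConvexClosedCurve a b γ) (hab : a < b)
    (hκ : ∀ u, curvature γ u ≠ 0) : ∫ u in a..b, speed γ u * curvature γ u = 2 * Real.pi := by
  have hc := continuous_speed_mul_curvature h.smooth h.regular
  have hpos : ∀ u, 0 < speed γ u * curvature γ u := fun u =>
    mul_pos (speed_pos h.regular u) (h.curvature_pos hκ u)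
  obtain ⟨n, hn⟩ := exists_int_total_curvature h.smooth h.regular h.periodic
  have hpi := Real.two_pi_pos
  have hpos' : 0 < ∫ u in a..b, speed γ u * curvature γ u :=
    intervalIntegral.intervalIntegral_pos_of_pos (hc.intervalIntegrable _ _) hpos hab
  have hn1 : 1 ≤ n := by
    rw [hn] at hpos'
    have : (0 : ℝ) < n := pos_of_mul_pos_left hpos' hpi.le
    exact_mod_cast this
  rcases hn1.eq_or_lt with rfl | hn2
  · simpa using hn
  exfalso
  have hcont : Continuous fun x => ∫ u in a..x, speed γ u * curvature γ u :=
    intervalIntegral.continuous_primitive (fun _ _ => hc.intervalIntegrable _ _) a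
  have hlt : 2 * Real.pi < ∫ u in a..b, speed γ u * curvature γ u := by
    rw [hn]
    have : (2 : ℝ) ≤ n := by exact_mod_cast hn2
    nlinarith
  -- With two or more turns, the angle completes a full turn at some x strictly between a and b. The
  -- tangents at x and a agree, so the points do, against injectivity on [a, b).
  obtain ⟨x, hx, hxe⟩ := intermediate_value_Ioo hab.le hcont.continuousOn
    (show 2 * Real.pi ∈ Ioo _ _ from ⟨by simpa using hpi, hlt⟩)
  have ht : tangentC γ x = tangentC γ a := by
    rw [tangentC_eq_exp_mul h.smooth h.regular a x]
    simp only at hxe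
    rw [hxe]
    push_cast
    rw [Complex.exp_two_pi_mul_I, one_mul]
  have := h.simple ⟨hx.1.le, hx.2⟩ ⟨le_rfl, hab⟩
    (h.eq_of_tangent_eq (hκ x) (tangentC_injective ht))
  exact hx.1.ne' this

end Convex

/-! ### The length inequality -/

/-- `∫ g ∫ κ g ≤ ∫ κ² g ∫ g / κ` in terms of `λ = ∫ κ g / ∫ g / κ`. -/
lemma integral_mul_sub_div_nonneg {a b c l : ℝ} (hab : a < b) {g κ : ℝ → ℝ} (hg : Continuous g)
    (hκ : Continuous κ) (hg0 : ∀ u, 0 < g u) (hκ0 : ∀ u, 0 < κ u) (hc : 0 < c)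
    (hint : ∫ u in a..b, g u * κ u = c) (hl : l = c / ∫ u in a..b, (1 / κ u) * g u) :
    0 ≤ ∫ u in a..b, g u * κ u * (κ u - l / κ u) := by
  have hinv : Continuous fun u => 1 / κ u := continuous_const.div hκ fun u => (hκ0 u).ne'
  set L := ∫ u in a..b, g u with hL
  set J := ∫ u in a..b, (1 / κ u) * g u with hJ
  set Q := ∫ u in a..b, g u * κ u * κ u with hQ
  have ig : ∀ f : ℝ → ℝ, Continuous f → IntervalIntegrable f MeasureTheory.volume a b :=
    fun f hf => hf.intervalIntegrable _ _
  have hL0 : 0 < L := intervalIntegral.intervalIntegral_pos_of_pos (ig _ hg) hg0 hab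
  have hJ0 : 0 < J := intervalIntegral.intervalIntegral_pos_of_pos (ig _ (hinv.mul hg))
    (fun u => mul_pos (one_div_pos.2 (hκ0 u)) (hg0 u)) hab
  have hval : ∫ u in a..b, g u * κ u * (κ u - l / κ u) = Q - l * L := by
    rw [hQ, hL, ← intervalIntegral.integral_const_mul, ← intervalIntegral.integral_sub
      (ig _ (by fun_prop)) (ig _ (by fun_prop))]
    refine intervalIntegral.integral_congr fun u _ => ?_
    have := (hκ0 u).ne'
    field_simp
  -- Cauchy-Schwarz, obtained by expanding the square of κ minus its arc-length mean c/L.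
  have hQL : c ^ 2 ≤ Q * L := by
    have h : 0 ≤ ∫ u in a..b, g u * (κ u - c / L) ^ 2 :=
      intervalIntegral.integral_nonneg hab.le fun u _ => mul_nonneg (hg0 u).le (sq_nonneg _)
    have e : ∫ u in a..b, g u * (κ u - c / L) ^ 2 = Q - 2 * (c / L) * c + (c / L) ^ 2 * L := by
      rw [hQ, hL]
      -- Only the free-standing factor c becomes an integral; the two earlier occurrences lie in
      -- c/L.
      nth_rewrite 3 [← hint]
      rw [← hL, ← intervalIntegral.integral_const_mul,
        ← intervalIntegral.integral_const_mul ((c / L) ^ 2), ← intervalIntegral.integral_sub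
        (ig _ (by fun_prop)) (ig _ (by fun_prop)), ← intervalIntegral.integral_add
        (ig _ (by fun_prop)) (ig _ (by fun_prop))]
      exact intervalIntegral.integral_congr fun u _ => by ring
    rw [e] at h
    have h2 := mul_nonneg h hL0.le
    have : (Q - 2 * (c / L) * c + (c / L) ^ 2 * L) * L = Q * L - c ^ 2 := by
      field_simp
      ring
    linarith
  -- The same square, now with weight g/κ.
  have hJL : L ^ 2 ≤ J * c := by
    have h : 0 ≤ ∫ u in a..b, (1 / κ u) * g u * (κ u - c / L) ^ 2 :=
      intervalIntegral.integral_nonneg hab.le fun u _ =>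
        mul_nonneg (mul_nonneg (one_div_pos.2 (hκ0 u)).le (hg0 u).le) (sq_nonneg _)
    have e : ∫ u in a..b, (1 / κ u) * g u * (κ u - c / L) ^ 2
        = c - 2 * (c / L) * L + (c / L) ^ 2 * J := by
      have e1 : ∀ u, (1 / κ u) * g u * (κ u - c / L) ^ 2
          = g u * κ u - 2 * (c / L) * g u + (c / L) ^ 2 * ((1 / κ u) * g u) := by
        intro u
        have := (hκ0 u).ne'
        field_simp
        ring
      simp only [e1]
      rw [intervalIntegral.integral_add (ig _ (by fun_prop)) (ig _ (by fun_prop)),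
        intervalIntegral.integral_sub (ig _ (by fun_prop)) (ig _ (by fun_prop)),
        intervalIntegral.integral_const_mul, intervalIntegral.integral_const_mul, hint]
    rw [e] at h
    have h2 := mul_nonneg h (by positivity : 0 ≤ L ^ 2 / c)
    have : (c - 2 * (c / L) * L + (c / L) ^ 2 * J) * (L ^ 2 / c) = J * c - L ^ 2 := by
      field_simp
      ring
    linarith
  have hQ0 : 0 ≤ Q := intervalIntegral.integral_nonneg hab.le fun u _ =>
    (mul_pos (mul_pos (hg0 u) (hκ0 u)) (hκ0 u)).le
  rw [hval, hl, sub_nonneg, div_mul_eq_mul_div, div_le_iff₀ hJ0]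
  have h3 : c ^ 2 * L ^ 2 ≤ (Q * L) * (J * c) := mul_le_mul hQL hJL (by positivity) (by positivity)
  have h4 : (c * L) * (c * L) ≤ (Q * J) * (c * L) := by linarith
  exact le_of_mul_le_mul_right h4 (by positivity)

/-! ### Solutions of the flow -/

namespace IsSolution

variable {a b : ℝ} {T : EReal} {X₀ : ℝ → Plane} {X : ℝ → ℝ → Plane}

/-- The space-time map of a family of curves. -/
abbrev flowMap (X : ℝ → ℝ → Plane) (p : ℝ × ℝ) : Plane := X p.1 p.2

/-- The derivative `X_u` as a function on space-time. -/
abbrev spaceDeriv (T : EReal) (X : ℝ → ℝ → Plane) : ℝ × ℝ → Plane :=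
  partialWithin (timeInterval T) (1, 0) (flowMap X)

/-- The velocity `X_t` as a function on space-time. -/
abbrev velocity (T : EReal) (X : ℝ → ℝ → Plane) : ℝ × ℝ → Plane :=
  partialWithin (timeInterval T) (0, 1) (flowMap X)

/-- The unit tangent as a function on space-time. -/
def unitTangent (T : EReal) (X : ℝ → ℝ → Plane) (p : ℝ × ℝ) : Plane :=
  ‖spaceDeriv T X p‖⁻¹ • spaceDeriv T X p

variable (hX : IsSolution a b T X₀ X)
include hX

lemma contDiff_slice {t : ℝ} (ht : t ∈ timeInterval T) : ContDiff ℝ ∞ fun u => X u t :=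
  contDiffOn_univ.1 <| hX.smooth.comp (f := fun u : ℝ => (u, t))
    (contDiff_id.prodMk contDiff_const).contDiffOn fun _ _ => ⟨mem_univ _, ht⟩

lemma deriv_slice {t : ℝ} (ht : t ∈ timeInterval T) (u : ℝ) :
    deriv (fun v => X v t) u = spaceDeriv T X (u, t) :=
  (hasDerivAt_partialWithin hX.smooth ht u).deriv

lemma spaceDeriv_ne_zero {p : ℝ × ℝ} (hp : p ∈ univ ×ˢ timeInterval T) :
    spaceDeriv T X p ≠ 0 := by
  rw [← hX.deriv_slice hp.2]
  exact hX.regular p.2 hp.2 p.1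

lemma tangent_slice {t : ℝ} (ht : t ∈ timeInterval T) (u : ℝ) :
    tangent (fun v => X v t) u = unitTangent T X (u, t) := by
  rw [tangent, arcDeriv, speed, hX.deriv_slice ht, unitTangent]

lemma contDiffOn_unitTangent (hT : 0 < T) :
    ContDiffOn ℝ ∞ (unitTangent T X) (univ ×ˢ timeInterval T) := by
  have h := contDiffOn_partialWithin (convex_timeInterval T) (interior_timeInterval_nonempty hT)
    hX.smooth (1, 0)
  exact ((h.norm ℝ fun p hp => hX.spaceDeriv_ne_zero hp).inv fun p hp =>
    norm_ne_zero_iff.2 (hX.spaceDeriv_ne_zero hp)).smul h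

lemma hasDerivAt_tangent_slice (hT : 0 < T) {t : ℝ} (ht : t ∈ timeInterval T) (u : ℝ) :
    HasDerivAt (tangent fun v => X v t)
      (partialWithin (timeInterval T) (1, 0) (unitTangent T X) (u, t)) u := by
  rw [show (tangent fun v => X v t) = fun v => unitTangent T X (v, t) from
    funext fun v => hX.tangent_slice ht v]
  exact hasDerivAt_partialWithin (hX.contDiffOn_unitTangent hT) ht u

/-- The total curvature of the evolving curve is `2π` at all times. -/
lemma total_curvature (hT : 0 < T) (hab : a < b) (hX₀ : IsConvexClosedCurve a b X₀) {t : ℝ}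
    (ht : t ∈ timeInterval T) :
    ∫ u in a..b, speed (fun v => X v t) u * curvature (fun v => X v t) u = 2 * Real.pi := by
  -- The curvature integrand in space-time form, where joint continuity in (u, t) is available.
  set K : ℝ × ℝ → ℝ := fun p =>
    ⟪partialWithin (timeInterval T) (1, 0) (unitTangent T X) p, rotL (unitTangent T X p)⟫ with hK
  have hS := convex_timeInterval T
  have hsm := hX.contDiffOn_unitTangent hT
  have hKc : ContinuousOn K (univ ×ˢ timeInterval T) :=
    (contDiffOn_partialWithin hS (interior_timeInterval_nonempty hT) hsm
      (1, 0)).continuousOn.inner (rotL.continuous.comp_continuousOn hsm.continuousOn)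
  have hKe : ∀ s ∈ timeInterval T, ∀ u,
      speed (fun v => X v s) u * curvature (fun v => X v s) u = K (u, s) := by
    intro s hs u
    rw [speed_mul_curvature (hX.regular s hs), (hX.hasDerivAt_tangent_slice hT hs u).deriv,
      hX.tangent_slice hs]
    rfl
  have h0 := zero_mem_timeInterval hT
  have hX0 : (fun v => X v 0) = X₀ := funext hX.initial
  have hκ0 : ∀ u, curvature X₀ u ≠ 0 := by
    rw [← hX0]
    exact hX.curvature_ne_zero 0 h0
  have hzero := hX₀.total_curvature hab hκ0
  rw [← hX0] at hzero
  simp only [hKe t ht]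
  simp only [hKe 0 h0] at hzero
  rw [← hzero]
  refine intervalIntegral_const_of_int_valued hS Real.two_pi_pos.ne' hKc (fun s hs => ?_) ht h0
  simp only [← hKe s hs]
  exact exists_int_total_curvature (hX.contDiff_slice hs) (hX.regular s hs) (hX.periodic s hs)

/-- The evolving curve has positive curvature at all times. -/
lemma curvature_pos (hT : 0 < T) (hab : a < b) (hX₀ : IsConvexClosedCurve a b X₀) {t : ℝ}
    (ht : t ∈ timeInterval T) (u : ℝ) : 0 < curvature (fun v => X v t) u := by
  by_contra! hu
  have hc := continuous_curvature (hX.contDiff_slice ht) (hX.regular t ht)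
  have hneg : ∀ v, curvature (fun v => X v t) v ≤ 0 := by
    intro v
    by_contra! hv
    -- A change of sign would produce a zero of κ. So κ ≤ 0 everywhere, which the total curvature 2π
    -- excludes.
    obtain ⟨w, hw⟩ := mem_range_of_exists_le_of_exists_ge hc ⟨u, hu⟩ ⟨v, hv.le⟩
    exact hX.curvature_ne_zero t ht w hw
  have hi : 0 ≤ ∫ u in a..b, -(speed (fun v => X v t) u * curvature (fun v => X v t) u) :=
    intervalIntegral.integral_nonneg hab.le fun v _ => neg_nonneg.2
      (mul_nonpos_of_nonneg_of_nonpos (speed_pos (hX.regular t ht) v).le (hneg v))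
  rw [intervalIntegral.integral_neg, hX.total_curvature hT hab hX₀ ht] at hi
  linarith [Real.two_pi_pos]

/-- Derivatives within the time interval are unique, even at t = 0, so the space-time velocity is
the right-hand side of the flow. -/
lemma velocity_eq (hT : 0 < T) {t : ℝ} (ht : t ∈ timeInterval T) (u : ℝ) :
    velocity T X (u, t) = tangentialSpeed a b (fun v => X v t) u • tangent (fun v => X v t) u
      + normalSpeed a b (fun v => X v t) u • rot (tangent (fun v => X v t) u) := by
  have hu := uniqueDiffOn_convex (convex_timeInterval T) (interior_timeInterval_nonempty hT) t ht
  rw [← normal_eq_rot_tangent (hX.contDiff_slice ht) (hX.regular t ht)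
    (hX.curvature_ne_zero t ht u)]
  exact hu.eq_deriv _ (hasDerivWithinAt_partialWithin hX.smooth ht u) (hX.evolution t ht u)

/-- The evolution of length and of area sees the flow equation only through this normal component.
-/
lemma inner_rot_tangent_velocity (hT : 0 < T) {t : ℝ} (ht : t ∈ timeInterval T) (u : ℝ) :
    ⟪rot (tangent (fun v => X v t) u), velocity T X (u, t)⟫
      = normalSpeed a b (fun v => X v t) u := by
  have h := inner_tangent_self (hX.regular t ht) u
  rw [hX.velocity_eq hT ht u]
  rw [inner_plane] at h ⊢
  simp only [PiLp.add_apply, PiLp.smul_apply, rot_zero, rot_one, smul_eq_mul]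
  linear_combination normalSpeed a b (fun v => X v t) u * h

/-- Makes the boundary terms cancel in both integrations by parts. -/
lemma velocity_endpoints (hT : 0 < T) {t : ℝ} (ht : t ∈ timeInterval T) :
    velocity T X (b, t) = velocity T X (a, t) := by
  have hu := uniqueDiffOn_convex (convex_timeInterval T) (interior_timeInterval_nonempty hT) t ht
  have hper : ∀ τ ∈ timeInterval T, X b τ = X a τ := fun τ hτ => by
    have := hX.periodic τ hτ a
    simpa using this
  exact hu.eq_deriv _ (hasDerivWithinAt_partialWithin hX.smooth ht b)
    ((hasDerivWithinAt_partialWithin hX.smooth ht a).congr hper (hper t ht))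

/-- The interchange X_tu = X_ut. -/
lemma hasDerivAt_velocity (hT : 0 < T) {t : ℝ} (ht : t ∈ timeInterval T) (u : ℝ) :
    HasDerivAt (fun v => velocity T X (v, t))
      (partialWithin (timeInterval T) (0, 1) (spaceDeriv T X) (u, t)) u := by
  have hS := convex_timeInterval T
  have hi := interior_timeInterval_nonempty hT
  rw [partialWithin_comm hS hi hX.smooth (0, 1) (1, 0) ⟨mem_univ _, ht⟩]
  exact hasDerivAt_partialWithin (contDiffOn_partialWithin hS hi hX.smooth (0, 1)) ht u

/-- The evolution of the length. -/
lemma hasDerivWithinAt_length (hT : 0 < T) (hab : a < b) {t : ℝ} (ht : t ∈ timeInterval T) :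
    HasDerivWithinAt (fun τ => length a b fun u => X u τ)
      (-∫ u in a..b, speed (fun v => X v t) u * curvature (fun v => X v t) u *
        normalSpeed a b (fun v => X v t) u) (timeInterval T) t := by
  have hS := convex_timeInterval T
  have hi := interior_timeInterval_nonempty hT
  have hsm := contDiffOn_partialWithin hS hi hX.smooth (1, 0)
  have hsW := contDiffOn_partialWithin hS hi hsm (0, 1)
  have hsT := hX.contDiffOn_unitTangent hT
  have hTW := hsT.continuousOn.inner (𝕜 := ℝ) hsW.continuousOn
  have hmain := hasDerivWithinAt_intervalIntegral_of_continuousOn hS hab.le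
    (F := fun u τ => ‖spaceDeriv T X (u, τ)‖)
    (F' := fun u τ => ⟪unitTangent T X (u, τ),
      partialWithin (timeInterval T) (0, 1) (spaceDeriv T X) (u, τ)⟫)
    (fun τ hτ => (continuous_slice hsm.continuousOn hτ).norm) hTW
    (fun τ hτ u => by
      have hd := hasDerivWithinAt_partialWithin hsm hτ u
      have hne : spaceDeriv T X (u, τ) ≠ 0 := hX.spaceDeriv_ne_zero ⟨mem_univ _, hτ⟩
      have h := hd.norm_sq.sqrt (pow_ne_zero 2 (norm_ne_zero_iff.2 hne))
      simp only [Real.sqrt_sq (norm_nonneg _)] at h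
      refine h.congr_deriv ?_
      rw [unitTangent, real_inner_smul_left]
      have := norm_ne_zero_iff.2 hne
      field_simp) ht
  have hl : ∀ τ ∈ timeInterval T, length a b (fun u => X u τ)
      = ∫ u in a..b, ‖spaceDeriv T X (u, τ)‖ := fun τ hτ => by
    simp only [length, speed, hX.deriv_slice hτ]
  refine (hmain.congr hl (hl t ht)).congr_deriv ?_
  set γ : ℝ → Plane := fun v => X v t with hγ
  have hγs := hX.contDiff_slice ht
  have hγr := hX.regular t ht
  -- Integration by parts: the Frenet equation turns the derivative falling on the tangent into gκ
  -- times the normal speed.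
  have hd : ∀ u, HasDerivAt (fun v => ⟪tangent γ v, velocity T X (v, t)⟫)
      (⟪unitTangent T X (u, t),
        partialWithin (timeInterval T) (0, 1) (spaceDeriv T X) (u, t)⟫
        + speed γ u * curvature γ u * normalSpeed a b γ u) u := by
    intro u
    refine ((hasDerivAt_tangent hγs hγr u).inner ℝ (hX.hasDerivAt_velocity hT ht u)).congr_deriv ?_
    rw [hX.tangent_slice ht, deriv_tangent hγs hγr, real_inner_smul_left,
      hX.inner_rot_tangent_velocity hT ht]
  have hc1 : Continuous fun u => ⟪unitTangent T X (u, t),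
      partialWithin (timeInterval T) (0, 1) (spaceDeriv T X) (u, t)⟫ := continuous_slice hTW ht
  have hc2 : Continuous fun u => speed γ u * curvature γ u * normalSpeed a b γ u := by
    refine (continuous_speed_mul_curvature hγs hγr).mul ?_
    have := continuous_curvature hγs hγr
    exact this.sub (continuous_const.div this (hX.curvature_ne_zero t ht))
  have hftc := intervalIntegral.integral_eq_sub_of_hasDerivAt (fun u _ => hd u)
    ((hc1.add hc2).intervalIntegrable a b)
  have hTper : tangent γ b = tangent γ a := by
    have := periodic_tangent (hX.periodic t ht) a
    rwa [add_sub_cancel] at this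
  rw [hX.velocity_endpoints hT ht, hTper, sub_self, intervalIntegral.integral_add
    (hc1.intervalIntegrable _ _) (hc2.intervalIntegrable _ _)] at hftc
  linarith

/-- The evolution of the area. -/
lemma hasDerivWithinAt_area (hT : 0 < T) (hab : a < b) {t : ℝ} (ht : t ∈ timeInterval T) :
    HasDerivWithinAt (fun τ => area a b fun u => X u τ)
      (-∫ u in a..b, speed (fun v => X v t) u * normalSpeed a b (fun v => X v t) u)
      (timeInterval T) t := by
  have hS := convex_timeInterval T
  have hi := interior_timeInterval_nonempty hT
  have hsm := contDiffOn_partialWithin hS hi hX.smooth (1, 0)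
  have hsW := (contDiffOn_partialWithin hS hi hsm (0, 1)).continuousOn
  have hsV := (contDiffOn_partialWithin hS hi hX.smooth (0, 1)).continuousOn
  have hsX := hX.smooth.continuousOn
  have hsU := hsm.continuousOn
  have coord : ∀ {G : ℝ × ℝ → Plane} (_ : ContinuousOn G (univ ×ˢ timeInterval T)) (i : Fin 2),
      ContinuousOn (fun p => G p i) (univ ×ˢ timeInterval T) := fun hG i =>
    (EuclideanSpace.proj (𝕜 := ℝ) i).continuous.comp_continuousOn hG
  have coordW : ∀ {f : ℝ → Plane} {f' : Plane} {τ : ℝ} (_ : HasDerivWithinAt f f' (timeInterval T) τ)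
      (i : Fin 2), HasDerivWithinAt (fun v => f v i) (f' i) (timeInterval T) τ := fun hf i =>
    (EuclideanSpace.proj (𝕜 := ℝ) i).hasFDerivAt.comp_hasDerivWithinAt _ hf
  set U := spaceDeriv T X with hU
  set V := velocity T X with hV
  set W := partialWithin (timeInterval T) (0, 1) U with hW
  have hI : ContinuousOn (fun p : ℝ × ℝ => V p 0 * U p 1 + X p.1 p.2 0 * W p 1
      - (V p 1 * U p 0 + X p.1 p.2 1 * W p 0)) (univ ×ˢ timeInterval T) :=
    (((coord hsV 0).mul (coord hsU 1)).add ((coord hsX 0).mul (coord hsW 1))).sub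
      (((coord hsV 1).mul (coord hsU 0)).add ((coord hsX 1).mul (coord hsW 0)))
  have hmain := (hasDerivWithinAt_intervalIntegral_of_continuousOn hS hab.le
    (F := fun u τ => X u τ 0 * U (u, τ) 1 - X u τ 1 * U (u, τ) 0)
    (F' := fun u τ => V (u, τ) 0 * U (u, τ) 1 + X u τ 0 * W (u, τ) 1
      - (V (u, τ) 1 * U (u, τ) 0 + X u τ 1 * W (u, τ) 0))
    (fun τ hτ => continuous_slice (((coord hsX 0).mul (coord hsU 1)).sub
      ((coord hsX 1).mul (coord hsU 0))) hτ) hI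
    (fun τ hτ u => by
      have h1 := hasDerivWithinAt_partialWithin hX.smooth hτ u
      have h2 := hasDerivWithinAt_partialWithin hsm hτ u
      exact ((coordW h1 0).mul (coordW h2 1)).sub ((coordW h1 1).mul (coordW h2 0)))
    ht).const_mul (1 / 2)
  have hl : ∀ τ ∈ timeInterval T, area a b (fun u => X u τ)
      = 1 / 2 * ∫ u in a..b, (X u τ 0 * U (u, τ) 1 - X u τ 1 * U (u, τ) 0) := fun τ hτ => by
    simp only [area, hX.deriv_slice hτ, hU]
  refine (hmain.congr hl (hl t ht)).congr_deriv ?_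
  set γ : ℝ → Plane := fun v => X v t with hγ
  have hγs := hX.contDiff_slice ht
  have hγr := hX.regular t ht
  -- With × the planar determinant, ∂_u(X × X_t) = (X_t × X_u + X × X_ut) + 2 X_u × X_t, and X_u ×
  -- X_t is g times the normal speed.
  have hd : ∀ u, HasDerivAt (fun v => X v t 0 * V (v, t) 1 - X v t 1 * V (v, t) 0)
      (V (u, t) 0 * U (u, t) 1 + X u t 0 * W (u, t) 1
        - (V (u, t) 1 * U (u, t) 0 + X u t 1 * W (u, t) 0)
        + 2 * (speed γ u * normalSpeed a b γ u)) u := by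
    intro u
    have h1 := hasDerivAt_partialWithin hX.smooth ht u
    have h2 := hX.hasDerivAt_velocity hT ht u
    refine (((hasDerivAt_coord h1 0).mul (hasDerivAt_coord h2 1)).sub
      ((hasDerivAt_coord h1 1).mul (hasDerivAt_coord h2 0))).congr_deriv ?_
    have hn := hX.inner_rot_tangent_velocity hT ht u
    have hUe : U (u, t) = speed γ u • tangent γ u := by
      rw [hU, ← hX.deriv_slice ht, deriv_eq_speed_smul_tangent hγr]
    rw [inner_plane, rot_zero, rot_one] at hn
    rw [← hn]
    simp only [← hU, ← hV, ← hW, hUe, PiLp.smul_apply, smul_eq_mul]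
    ring
  have hc1 := continuous_slice hI ht
  have hc2 : Continuous fun u => speed γ u * normalSpeed a b γ u := by
    have := continuous_curvature hγs hγr
    exact (contDiff_speed hγs hγr).continuous.mul
      (this.sub (continuous_const.div this (hX.curvature_ne_zero t ht)))
  have hftc := intervalIntegral.integral_eq_sub_of_hasDerivAt (fun u _ => hd u)
    ((hc1.add (hc2.const_mul 2)).intervalIntegrable a b)
  have hXper : X b t = X a t := by
    have := hX.periodic t ht a
    simpa using this
  rw [hV, hX.velocity_endpoints hT ht, hXper, sub_self, intervalIntegral.integral_add
    (hc1.intervalIntegrable _ _) ((hc2.const_mul 2).intervalIntegrable _ _),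
    intervalIntegral.integral_const_mul] at hftc
  linarith

/-- The weighted normal speed has mean zero. -/
lemma integral_normalSpeed (hT : 0 < T) (hab : a < b) (hX₀ : IsConvexClosedCurve a b X₀) {t : ℝ}
    (ht : t ∈ timeInterval T) :
    ∫ u in a..b, speed (fun v => X v t) u * normalSpeed a b (fun v => X v t) u = 0 := by
  set γ : ℝ → Plane := fun v => X v t
  have hγs := hX.contDiff_slice ht
  have hγr := hX.regular t ht
  have hκ := continuous_curvature hγs hγr
  have hJ : Continuous fun u => 1 / curvature γ u * speed γ u :=
    (continuous_const.div hκ (hX.curvature_ne_zero t ht)).mul (contDiff_speed hγs hγr).continuous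
  have hJ0 : 0 < ∫ u in a..b, 1 / curvature γ u * speed γ u :=
    intervalIntegral.intervalIntegral_pos_of_pos (hJ.intervalIntegrable _ _)
      (fun u => mul_pos (one_div_pos.2 (hX.curvature_pos hT hab hX₀ ht u)) (speed_pos hγr u)) hab
  have he : ∀ u, speed γ u * normalSpeed a b γ u = speed γ u * curvature γ u
      - nonlocalTerm a b γ * (1 / curvature γ u * speed γ u) := fun u => by
    rw [normalSpeed]
    ring
  simp only [he]
  -- The denominator of λ cancels ∮ ds/κ and leaves 2π, the total curvature.
  rw [intervalIntegral.integral_sub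
    ((continuous_speed_mul_curvature hγs hγr).intervalIntegrable _ _)
    ((hJ.const_mul _).intervalIntegrable _ _), intervalIntegral.integral_const_mul,
    hX.total_curvature hT hab hX₀ ht, nonlocalTerm, div_mul_cancel₀ _ hJ0.ne', sub_self]

end IsSolution

end CurveFlow

end

theorem mainTheorem6 (a b : ℝ) (hab : a < b) (T : EReal) (hT : 0 < T)
    (X₀ : ℝ → CurveFlow.Plane) (hX₀ : CurveFlow.IsConvexClosedCurve a b X₀)
    (X : ℝ → ℝ → CurveFlow.Plane) (hX : CurveFlow.IsSolution a b T X₀ X) :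
    ∀ t ∈ CurveFlow.timeInterval T,
      HasDerivWithinAt (fun τ => CurveFlow.area a b (fun u => X u τ)) 0
        (CurveFlow.timeInterval T) t ∧
      ∃ L' : ℝ,
        HasDerivWithinAt (fun τ => CurveFlow.length a b (fun u => X u τ)) L'
          (CurveFlow.timeInterval T) t ∧
        L' ≤ 0 := by
  intro t ht
  refine ⟨?_, _, hX.hasDerivWithinAt_length hT hab ht, neg_nonpos.2 ?_⟩
  · simpa [hX.integral_normalSpeed hT hab hX₀ ht] using hX.hasDerivWithinAt_area hT hab ht
  · have hs := hX.contDiff_slice ht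
    have hr := hX.regular t ht
    exact CurveFlow.integral_mul_sub_div_nonneg hab (CurveFlow.contDiff_speed hs hr).continuous
      (CurveFlow.continuous_curvature hs hr) (CurveFlow.speed_pos hr)
      (hX.curvature_pos hT hab hX₀ ht) Real.two_pi_pos (hX.total_curvature hT hab hX₀ ht) rfl
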